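/- Let $A\in\mathbb{R}^{n\times n}$ be invertible, let $V,W\in\mathbb{R}^{n\times m}$ have full rank $m$ with $\det(W^TAV)\neq 0$, let $b,x_0\in\mathbb{R}^n$, and let $\Psi\in\mathbb{R}^{n\times n}$ be symmetric positive semidefinite with $W^TA\Psi=0$. Let $\alpha,\beta>0$, let $s$ be a random variable with the inverse-gamma distribution $\mathsf{IG}(\alpha,\beta)$, i.e. with density $\frac{\beta^\alpha}{\Gamma(\alpha)}s^{-(\alpha+1)}e^{-\beta/s}$ on $s>0$, and let $x$ be a random vector in $\mathbb{R}^n$ whose conditional distribution given $s$ is the normal distribution $\mathcal{N}\left(x_0,\,s(VV^T+\Psi)\right)$. Put $$\delta=(W^TAV)^{-1}W^T(b-Ax_0),\qquad \widetilde x=x_0+V\delta,\qquad \widetilde\alpha=\alpha+\frac m2,\qquad \widetilde\beta=\beta+\frac{\delta^T\delta}{2}.$$ Then: 1. The conditional distribution of $s$ given $W^TAx=W^Tb$ is $\mathsf{IG}(\widetilde\alpha,\widetilde\beta)$. 2. The (predictive) conditional distribution of $x$ given $W^TAx=W^Tb$ is the multivariate Student distribution $\mathsf{St}_{2\widetilde\alpha}\left(\widetilde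 x,\,\frac{\widetilde\beta}{\widetilde\alpha}\Psi\right)$. Here, for $\nu>0$, $\mu\in\mathbb{R}^n$ and a symmetric positive semidefinite $\Sigma=UDU^T$ of rank $k$, where $U\in\mathbb{R}^{n\times k}$ has orthonormal columns and $D>0$ is diagonal, $\mathsf{St}_\nu(\mu,\Sigma)$ is the distribution on the affine subspace $\mu+\mathrm{range}(\Sigma)$ that has the density $$\frac{\Gamma\left(\frac{\nu+k}{2}\right)}{\Gamma\left(\frac{\nu}{2}\right)\sqrt{(\pi\nu)^k\det D}}\left(1+\frac1\nu(x-\mu)^T\Sigma^{\dagger}(x-\mu)\right)^{-\frac{\nu+k}{2}}$$ with respect to $k$-dimensional Lebesgue measure on that subspace, and $\Sigma^\dagger=UD^{-1}U^T$. The conditional distribution of a random variable given the event $W^TAx=y$ is the value at $y$ of the version of its regular conditional distribution given $W^TAx$ that is continuous in $y$ with respect to weak convergence; part of the claim is that such a version exists and that its value at $y=W^Tb$ is uniquely determined. -/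

import Mathlib

open MeasureTheory ProbabilityTheory Matrix

namespace ProbProj

noncomputable section

/-! ### The inverse-gamma distribution -/

/-- Density of the inverse-gamma distribution with shape `a` and scale `r`:
`r ^ a / Γ(a) * s ^ (-(a + 1)) * exp (-r / s)` for `s > 0`, and `0` otherwise. -/
def invGammaPDFReal (a r s : ℝ) : ℝ :=
  if 0 < s then r ^ a / Real.Gamma a * s ^ (-(a + 1)) * Real.exp (-r / s) else 0

/-- The inverse-gamma distribution on `ℝ` with shape `a` and scale `r`. -/
def invGamma (a r : ℝ) : Measure ℝ :=
  volume.withDensity fun s => ENNReal.ofReal (invGammaPDFReal a r s)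

/-! ### The multivariate Student distribution with a possibly singular scale matrix -/

section Student

variable {n : ℕ} {S : Matrix (Fin n) (Fin n) ℝ}

/-- Indices of the nonzero eigenvalues of a symmetric matrix, listed with multiplicity. -/
abbrev SpecIdx (hS : S.IsHermitian) : Type := {i : Fin n // hS.eigenvalues i ≠ 0}

/-- The matrix `U` of the reduced spectral decomposition `S = U D Uᵀ`: its columns are orthonormal
eigenvectors for the nonzero eigenvalues. -/
def specU (hS : S.IsHermitian) : Matrix (Fin n) (SpecIdx hS) ℝ :=
  fun i j => (hS.eigenvectorUnitary : Matrix (Fin n) (Fin n) ℝ) i j.1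

/-- The diagonal of `D` in the reduced spectral decomposition `S = U D Uᵀ`. -/
def specD (hS : S.IsHermitian) : SpecIdx hS → ℝ := fun j => hS.eigenvalues j.1

/-- The Moore-Penrose inverse `S† = U D⁻¹ Uᵀ` of a symmetric matrix. -/
def pinv (hS : S.IsHermitian) : Matrix (Fin n) (Fin n) ℝ :=
  specU hS * diagonal (fun j => (specD hS j)⁻¹) * (specU hS)ᵀ

/-- The `k`-dimensional Lebesgue measure, `k = rank S`, on the affine subspace `μ + range S`: the
image of Lebesgue measure on `ℝᵏ` under the isometric parametrization `v ↦ μ + U v`. -/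
def affineVolume (μ : EuclideanSpace ℝ (Fin n)) (hS : S.IsHermitian) :
    Measure (EuclideanSpace ℝ (Fin n)) :=
  (volume : Measure (SpecIdx hS → ℝ)).map fun v => μ + WithLp.toLp 2 (specU hS *ᵥ v)

/-- Density of the multivariate Student distribution with `ν` degrees of freedom, location `μ` and
scale matrix `S ≥ 0` of rank `k`, with respect to Lebesgue measure on `μ + range S`:
`Γ((ν + k) / 2) / (Γ(ν / 2) √((π ν) ^ k det D)) * (1 + (x - μ)ᵀ S† (x - μ) / ν) ^ (-(ν + k) / 2)`. -/
def studentPDFReal (ν : ℝ) (μ : EuclideanSpace ℝ (Fin n)) (hS : S.IsHermitian)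
    (x : EuclideanSpace ℝ (Fin n)) : ℝ :=
  Real.Gamma ((ν + S.rank) / 2) /
      (Real.Gamma (ν / 2) * √((Real.pi * ν) ^ S.rank * ∏ j, specD hS j)) *
    (1 + 1 / ν * ((x - μ).ofLp ⬝ᵥ (pinv hS *ᵥ (x - μ).ofLp))) ^ (-((ν + S.rank) / 2))

open Classical in
/-- The multivariate Student distribution `St_ν(μ, S)`. As with Mathlib's `multivariateGaussian`,
a matrix `S` that is not positive semidefinite gives a meaningless default, the point mass
at `μ`. -/
def multivariateStudent (ν : ℝ) (μ : EuclideanSpace ℝ (Fin n)) (S : Matrix (Fin n) (Fin n) ℝ) :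
    Measure (EuclideanSpace ℝ (Fin n)) :=
  if hS : S.PosSemidef then
    (affineVolume μ hS.isHermitian).withDensity fun x =>
      ENNReal.ofReal (studentPDFReal ν μ hS.isHermitian x)
  else Measure.dirac μ

end Student

/-! ### The Gaussian prior with an unknown scale -/

section Prior

open scoped MatrixOrder

variable {n : ℕ}

theorem multivariateGaussian_smul (μ : EuclideanSpace ℝ (Fin n)) {S : Matrix (Fin n) (Fin n) ℝ}
    (hS : S.PosSemidef) (s : ℝ) :
    multivariateGaussian μ (s • S) = (stdGaussian (EuclideanSpace ℝ (Fin n))).map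
      fun g => μ + √s • toEuclideanCLM (𝕜 := ℝ) (CFC.sqrt S) g := by
  have hzero : ∀ t : ℝ, t ≤ 0 → multivariateGaussian μ (t • S) = Measure.dirac μ := by
    intro t ht
    by_cases h : (t • S).PosSemidef
    · have h0 : t • S = 0 := by
        refine le_antisymm ?_ h.nonneg
        have h1 : 0 ≤ (-t) • S := (hS.smul (neg_nonneg.2 ht)).nonneg
        simpa using h1
      simp [multivariateGaussian, h0]
    · exact multivariateGaussian_of_not_posSemidef μ h
  rcases le_total s 0 with h | h
  · rw [hzero s h]
    simp [Real.sqrt_eq_zero_of_nonpos h]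
  · have h1 : CFC.sqrt (s • S) = √s • CFC.sqrt S := by
      apply CFC.sqrt_unique
      · rw [smul_mul_smul_comm, Real.mul_self_sqrt h, CFC.sqrt_mul_sqrt_self _ hS.nonneg]
      · have h2 : (CFC.sqrt S).PosSemidef := Matrix.nonneg_iff_posSemidef.1 (CFC.sqrt_nonneg S)
        exact (h2.smul (Real.sqrt_nonneg s)).nonneg
    rw [multivariateGaussian, h1]
    simp

/-- The Markov kernel `s ↦ N(μ, s S)`, for a positive semidefinite matrix `S`. -/
def gaussianScaleKernel (μ : EuclideanSpace ℝ (Fin n)) (S : Matrix (Fin n) (Fin n) ℝ)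
    (hS : S.PosSemidef) : Kernel ℝ (EuclideanSpace ℝ (Fin n)) where
  toFun s := multivariateGaussian μ (s • S)
  measurable' := by
    simp_rw [multivariateGaussian_smul μ hS]
    refine Measure.measurable_of_measurable_coe _ fun B hB => ?_
    have hf : Measurable fun p : ℝ × EuclideanSpace ℝ (Fin n) =>
        μ + √p.1 • toEuclideanCLM (𝕜 := ℝ) (CFC.sqrt S) p.2 := by fun_prop
    have h := measurable_measure_prodMk_left
      (ν := stdGaussian (EuclideanSpace ℝ (Fin n))) (hf hB)
    convert h using 2 with s
    rw [Measure.map_apply (by fun_prop) hB]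
    rfl

theorem posSemidef_prior {m : ℕ} (V : Matrix (Fin n) (Fin m) ℝ) {Ψ : Matrix (Fin n) (Fin n) ℝ}
    (hΨ : Ψ.PosSemidef) : (V * Vᵀ + Ψ).PosSemidef := by
  have h := posSemidef_self_mul_conjTranspose V
  rw [conjTranspose_eq_transpose_of_trivial] at h
  exact h.add hΨ

end Prior

/-! ### Conditioning on the value of a random variable -/

section Cond

variable {Ω 𝓧 𝓨 : Type*} [MeasurableSpace Ω] [TopologicalSpace 𝓧] [MeasurableSpace 𝓧]
  [TopologicalSpace 𝓨] [MeasurableSpace 𝓨]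

/-- `κ` is a version of the regular conditional distribution of `Y` given `X` which depends on the
value of `X` continuously in the topology of weak convergence of measures. -/
structure IsContCondDistrib (Y : Ω → 𝓨) (X : Ω → 𝓧) (κ : Kernel 𝓧 𝓨) (P : Measure Ω) : Prop where
  isMarkov : IsMarkovKernel κ
  hasCondDistrib : HasCondDistrib Y X κ P
  continuous : ∀ f : BoundedContinuousFunction 𝓨 ℝ, Continuous fun x => ∫ y, f y ∂(κ x)

/-- `ν` is the conditional law of `Y` given the (possibly null) event `X = x`: a weakly continuous
version of the conditional distribution of `Y` given `X` exists, and every such version has the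
value `ν` at the point `x`. -/
def IsCondLawAt (Y : Ω → 𝓨) (X : Ω → 𝓧) (x : 𝓧) (ν : Measure 𝓨) (P : Measure Ω) : Prop :=
  (∃ κ : Kernel 𝓧 𝓨, IsContCondDistrib Y X κ P) ∧
    ∀ κ : Kernel 𝓧 𝓨, IsContCondDistrib Y X κ P → κ x = ν

end Cond

/-! ### Projection methods -/

section Projection

variable {n m : ℕ}

/-- The coefficients `δ = (Wᵀ A V)⁻¹ Wᵀ (b - A x₀)` of the correction of a projection method. -/
def projCoeff (A : Matrix (Fin n) (Fin n) ℝ) (V W : Matrix (Fin n) (Fin m) ℝ) (b : Fin n → ℝ)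
    (x₀ : EuclideanSpace ℝ (Fin n)) : Fin m → ℝ :=
  (Wᵀ * A * V)⁻¹ *ᵥ (Wᵀ *ᵥ (b - A *ᵥ x₀.ofLp))

/-- The approximate solution `x₀ + V (Wᵀ A V)⁻¹ Wᵀ (b - A x₀)` of a projection method. -/
def projSolution (A : Matrix (Fin n) (Fin n) ℝ) (V W : Matrix (Fin n) (Fin m) ℝ) (b : Fin n → ℝ)
    (x₀ : EuclideanSpace ℝ (Fin n)) : EuclideanSpace ℝ (Fin n) :=
  x₀ + WithLp.toLp 2 (V *ᵥ projCoeff A V W b x₀)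

end Projection

end

end ProbProj

namespace ProbProj

noncomputable section

/-! ### The inverse-gamma distribution -/

/-! Write the prior as x = x₀ + √s (V z + R g) with R = √Ψ and s, z, g independent, z and g standard
normal. From WᵀAΨ = 0 follows WᵀAR = 0, so WᵀAx = WᵀAx₀ + (WᵀAV) d with d = √s z. As WᵀAV is
invertible, observing WᵀAx amounts to observing d, and at Wᵀb the value of d is δ. What remains is x
= x₀ + V d + √s R g, with g independent of (s, d).

The core is the conjugacy identity `invGamma_prod_stdNormalPi_map`: the joint density of (s, √s z)
is the marginal density of d times the density of IG(α + m/2, β + dᵀd/2) in s. This gives the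
posterior of s. The law of x is then an inverse-gamma mixture of the normal laws N(x₀ + Vδ, sΨ). The
same identity in dimension rank Ψ, read through its other marginal, identifies this mixture as a
Student law (`invGamma_prod_gaussianImage_map`).

For the conditioning on a null event, (s, x) is written as F(y, u), with F continuous in the
observation y and u = (t, g) of a fixed law, where s = (β + dᵀd/2) t (`map_observation_prodMk_eq`).
Hence the law of F(y, u) is weakly continuous in y. The observation has full support, so continuous
versions that agree almost everywhere agree everywhere (`isCondLawAt_of_map_eq`). -/

theorem measurable_invGammaPDFReal (a r : ℝ) : Measurable (invGammaPDFReal a r) := by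
  unfold invGammaPDFReal
  exact Measurable.ite measurableSet_Ioi (by fun_prop) measurable_const

/-- The substitution t = 1/s turns the density into that of a gamma distribution, whose integral is
known. -/
theorem isProbabilityMeasure_invGamma {a r : ℝ} (ha : 0 < a) (hr : 0 < r) :
    IsProbabilityMeasure (invGamma a r) := by
  let g : ℝ → ℝ := fun t => r ^ a / Real.Gamma a * (t ^ (a - 1) * Real.exp (-(r * t)))
  have hgi : IntegrableOn g (Set.Ioi 0) := by
    refine Integrable.const_mul ?_ _
    refine Integrable.of_integral_ne_zero (ne_of_gt ?_)
    rw [Real.integral_rpow_mul_exp_neg_mul_Ioi ha hr]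
    positivity
  have hg1 : ∫ t in Set.Ioi 0, g t = 1 := by
    rw [integral_const_mul, Real.integral_rpow_mul_exp_neg_mul_Ioi ha hr]
    have := (Real.Gamma_pos_of_pos ha).ne'
    rw [Real.div_rpow zero_le_one hr.le, Real.one_rpow]
    have := (Real.rpow_pos_of_pos hr a).ne'
    field_simp
  have heq : Set.EqOn (fun s : ℝ => (|(-1 : ℝ)| * s ^ ((-1 : ℝ) - 1)) • g (s ^ (-1 : ℝ)))
      (invGammaPDFReal a r) (Set.Ioi 0) := by
    intro s hs
    have hs' : 0 < s := hs
    simp only [g, invGammaPDFReal, if_pos hs', smul_eq_mul, abs_neg, abs_one, one_mul]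
    rw [← Real.rpow_mul hs'.le, Real.rpow_neg_one, ← div_eq_mul_inv, ← neg_div]
    rw [show -(a + 1) = ((-1 : ℝ) - 1) + -1 * (a - 1) by ring, Real.rpow_add hs']
    ring
  have hi : IntegrableOn (invGammaPDFReal a r) (Set.Ioi 0) :=
    ((integrableOn_Ioi_comp_rpow_iff g (p := -1) (by norm_num)).2 hgi).congr_fun heq
      measurableSet_Ioi
  have h1 : ∫ s in Set.Ioi 0, invGammaPDFReal a r s = 1 := by
    rw [← hg1, ← integral_comp_rpow_Ioi g (p := -1) (by norm_num)]
    exact (setIntegral_congr_fun measurableSet_Ioi heq).symm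
  constructor
  rw [invGamma, withDensity_apply _ MeasurableSet.univ, setLIntegral_univ]
  have hsupp : ∫⁻ s in Set.Ioi 0, ENNReal.ofReal (invGammaPDFReal a r s) =
      ∫⁻ s, ENNReal.ofReal (invGammaPDFReal a r s) := by
    refine setLIntegral_eq_of_support_subset ?_
    intro s hs
    by_contra h
    exact hs (by simp [invGammaPDFReal, show ¬ 0 < s from h])
  rw [← hsupp, ← ofReal_integral_eq_lintegral_ofReal hi, h1, ENNReal.ofReal_one]
  refine (ae_restrict_mem measurableSet_Ioi).mono fun s hs => ?_
  have hs' : 0 < s := hs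
  simp only [invGammaPDFReal, if_pos hs', Pi.zero_apply]
  positivity

/-- Since r is a scale parameter, a single law IG(a, 1) serves all data: the dependence on the
observation sits in a continuous factor. -/
theorem invGamma_map_mul (a : ℝ) {r : ℝ} (hr : 0 < r) :
    (invGamma a 1).map (fun t => r * t) = invGamma a r := by
  have hpdf : ∀ t, ENNReal.ofReal (invGammaPDFReal a 1 t) =
      ENNReal.ofReal |r| * ENNReal.ofReal (invGammaPDFReal a r (r * t)) := by
    intro t
    rw [← ENNReal.ofReal_mul (abs_nonneg r), abs_of_pos hr]
    congr 1
    by_cases ht : 0 < t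
    · have hrt : 0 < r * t := mul_pos hr ht
      simp only [invGammaPDFReal, if_pos ht, if_pos hrt, Real.one_rpow]
      rw [Real.mul_rpow hr.le ht.le, show -r / (r * t) = -1 / t by field_simp]
      rw [Real.rpow_neg hr.le, Real.rpow_add hr, Real.rpow_one]
      have := (Real.rpow_pos_of_pos hr a).ne'
      field_simp
    · have hrt : ¬ 0 < r * t := fun h => ht ((mul_pos_iff_of_pos_left hr).1 h)
      simp [invGammaPDFReal, ht, hrt]
  ext B hB
  have hm : Measurable fun t : ℝ => r * t := by fun_prop
  rw [Measure.map_apply hm hB, invGamma, invGamma, withDensity_apply _ (hm hB),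
    withDensity_apply _ hB]
  conv_rhs => rw [← Real.smul_map_volume_mul_left hr.ne']
  rw [Measure.restrict_smul, lintegral_smul_measure, setLIntegral_map hB
    (measurable_invGammaPDFReal a r).ennreal_ofReal hm, smul_eq_mul, ← lintegral_const_mul]
  · simp_rw [hpdf]
  · exact ((measurable_invGammaPDFReal a r).comp hm).ennreal_ofReal

/-! ### The standard Gaussian distribution on `ι → ℝ` -/

section StdGaussian

variable (ι : Type*) [Fintype ι]

/-- The law of a family of independent standard normal random variables. -/
def stdNormalPi : Measure (ι → ℝ) := Measure.pi fun _ => gaussianReal 0 1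

instance : IsProbabilityMeasure (stdNormalPi ι) := by unfold stdNormalPi; infer_instance

variable {ι}

/-- Density of the standard normal distribution on `ι → ℝ`. -/
def stdNormalPDFReal (z : ι → ℝ) : ℝ :=
  (2 * Real.pi) ^ (-(Fintype.card ι / 2 : ℝ)) * Real.exp (-(z ⬝ᵥ z) / 2)

theorem stdNormalPDFReal_eq_prod (z : ι → ℝ) :
    stdNormalPDFReal z = ∏ i, gaussianPDFReal 0 1 (z i) := by
  simp only [stdNormalPDFReal, gaussianPDFReal, Finset.prod_mul_distrib, Finset.prod_const,
    Finset.card_univ, ← Real.exp_sum]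
  congr 1
  · rw [NNReal.coe_one, mul_one, Real.sqrt_eq_rpow, ← Real.rpow_neg_one, ← Real.rpow_mul
      (by positivity), ← Real.rpow_natCast, ← Real.rpow_mul (by positivity)]
    congr 1
    ring
  · congr 1
    simp [dotProduct, ← Finset.sum_div, pow_two]

theorem measurable_stdNormalPDFReal : Measurable (stdNormalPDFReal (ι := ι)) := by
  simp_rw [funext stdNormalPDFReal_eq_prod]
  exact Finset.measurable_prod _ fun i _ =>
    (measurable_gaussianPDFReal 0 1).comp (measurable_pi_apply i)

/-- A product measure is determined by its values on boxes, where the integral of the product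
density factors. -/
theorem stdNormalPi_eq_withDensity : stdNormalPi ι =
    volume.withDensity fun z => ENNReal.ofReal (stdNormalPDFReal z) := by
  refine (Measure.pi_eq (μ := fun _ => gaussianReal 0 1) fun B hB => ?_)
  rw [withDensity_apply _ (MeasurableSet.univ_pi hB), volume_pi, Measure.restrict_pi_pi]
  simp_rw [stdNormalPDFReal_eq_prod]
  rw [← ofReal_integral_eq_lintegral_ofReal]
  · rw [integral_fintype_prod_eq_prod, ENNReal.ofReal_prod_of_nonneg]
    · refine Finset.prod_congr rfl fun i _ => ?_
      rw [gaussianReal_apply_eq_integral 0 one_ne_zero]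
    · exact fun i _ => integral_nonneg fun _ => gaussianPDFReal_nonneg _ _ _
  · exact Integrable.fintype_prod fun i => (integrable_gaussianPDFReal 0 1).restrict
  · exact ae_of_all _ fun z => Finset.prod_nonneg fun i _ => gaussianPDFReal_nonneg _ _ _

end StdGaussian

/-! ### Scale mixtures of Gaussian distributions -/

section Mixture

variable {ι : Type*} [Fintype ι]

/-- Density of `√s • z` for independent `s ∼ IG(a, r)` and standard normal `z`. -/
def mixturePDFReal (a r : ℝ) (d : ι → ℝ) : ℝ :=
  (2 * Real.pi) ^ (-(Fintype.card ι / 2 : ℝ)) * (r ^ a / Real.Gamma a) *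
    (Real.Gamma (a + Fintype.card ι / 2) * (r + d ⬝ᵥ d / 2) ^ (-(a + Fintype.card ι / 2 : ℝ)))

theorem add_dotProduct_self_pos {r : ℝ} (hr : 0 < r) (d : ι → ℝ) : 0 < r + d ⬝ᵥ d / 2 := by
  have : 0 ≤ d ⬝ᵥ d := Finset.sum_nonneg fun i _ => mul_self_nonneg _
  positivity

theorem mixturePDFReal_pos {a r : ℝ} (ha : 0 < a) (hr : 0 < r) (d : ι → ℝ) :
    0 < mixturePDFReal a r d := by
  have h := add_dotProduct_self_pos hr d
  unfold mixturePDFReal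
  positivity

theorem continuous_add_dotProduct_self (r : ℝ) :
    Continuous fun d : ι → ℝ => r + d ⬝ᵥ d / 2 := by
  unfold dotProduct
  fun_prop

theorem measurable_mixturePDFReal (a r : ℝ) :
    Measurable (mixturePDFReal a r : (ι → ℝ) → ℝ) := by
  have := (continuous_add_dotProduct_self (ι := ι) r).measurable
  unfold mixturePDFReal
  fun_prop

theorem invGammaPDFReal_nonneg {a r : ℝ} (ha : 0 < a) (hr : 0 < r) (s : ℝ) :
    0 ≤ invGammaPDFReal a r s := by
  unfold invGammaPDFReal
  split_ifs with h
  · positivity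
  · exact le_rfl

/-- The joint density of `(s, √s • z)` factors into the density of `√s • z` and the conditional
density of `s`. -/
theorem invGammaPDFReal_mul_stdNormalPDFReal {a r s : ℝ} (ha : 0 < a) (hr : 0 < r) (hs : 0 < s)
    (d : ι → ℝ) :
    invGammaPDFReal a r s * ((√s ^ Fintype.card ι)⁻¹ * stdNormalPDFReal ((√s)⁻¹ • d)) =
      mixturePDFReal a r d *
        invGammaPDFReal (a + Fintype.card ι / 2) (r + d ⬝ᵥ d / 2) s := by
  have hR := add_dotProduct_self_pos hr d
  simp only [invGammaPDFReal, if_pos hs, mixturePDFReal, stdNormalPDFReal]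
  have h1 : (√s ^ Fintype.card ι)⁻¹ = s ^ (-(Fintype.card ι / 2 : ℝ)) := by
    rw [Real.sqrt_eq_rpow, ← Real.rpow_natCast, ← Real.rpow_mul hs.le, Real.rpow_neg hs.le]
    congr 2
    ring
  have h2 : ((√s)⁻¹ • d) ⬝ᵥ ((√s)⁻¹ • d) = d ⬝ᵥ d / s := by
    rw [smul_dotProduct, dotProduct_smul, smul_eq_mul, smul_eq_mul, ← mul_assoc, ← mul_inv,
      Real.mul_self_sqrt hs.le]
    ring
  have h3 : Real.exp (-(r + d ⬝ᵥ d / 2) / s) =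
      Real.exp (-r / s) * Real.exp (-(d ⬝ᵥ d / s) / 2) := by
    rw [← Real.exp_add]
    congr 1
    ring
  have h4 : s ^ (-(a + Fintype.card ι / 2 + 1 : ℝ)) =
      s ^ (-(a + 1)) * s ^ (-(Fintype.card ι / 2 : ℝ)) := by
    rw [← Real.rpow_add hs]
    congr 1
    ring
  have h5 : (r + d ⬝ᵥ d / 2) ^ (-(a + Fintype.card ι / 2 : ℝ)) *
      (r + d ⬝ᵥ d / 2) ^ (a + Fintype.card ι / 2 : ℝ) = 1 := by
    rw [← Real.rpow_add hR, neg_add_cancel, Real.rpow_zero]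
  have hG : Real.Gamma (a + Fintype.card ι / 2) ≠ 0 :=
    (Real.Gamma_pos_of_pos (by positivity)).ne'
  rw [h1, h2, h3, h4]
  -- The constants of the marginal density of d cancel the normalising constants of the updated
  -- inverse-gamma density.
  have h6 : Real.Gamma (a + Fintype.card ι / 2) *
      (r + d ⬝ᵥ d / 2) ^ (-(a + Fintype.card ι / 2 : ℝ)) *
      ((r + d ⬝ᵥ d / 2) ^ (a + Fintype.card ι / 2 : ℝ) /
        Real.Gamma (a + Fintype.card ι / 2)) = 1 := by
    rw [mul_comm (Real.Gamma _), mul_assoc, mul_div_cancel₀ _ hG, h5]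
  linear_combination (-(r ^ a / Real.Gamma a * s ^ (-(a + 1)) * Real.exp (-r / s) *
    s ^ (-(Fintype.card ι / 2 : ℝ)) * Real.exp (-(d ⬝ᵥ d / s) / 2) *
    (2 * Real.pi) ^ (-(Fintype.card ι / 2 : ℝ)))) * h6

/-- Substitution d = √s z, where s > 0 makes the scaling invertible. -/
theorem lintegral_stdNormalPi_smul {s : ℝ} (hs : 0 < s) {f : (ι → ℝ) → ENNReal}
    (hf : Measurable f) :
    ∫⁻ z, f (√s • z) ∂stdNormalPi ι =
      ∫⁻ d, ENNReal.ofReal ((√s ^ Fintype.card ι)⁻¹ * stdNormalPDFReal ((√s)⁻¹ • d)) * f d := by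
  have hs' : √s ≠ 0 := (Real.sqrt_pos.2 hs).ne'
  have hφ : Measurable fun d : ι → ℝ => stdNormalPDFReal ((√s)⁻¹ • d) :=
    measurable_stdNormalPDFReal.comp (measurable_const_smul _)
  have hfs : Measurable fun z : ι → ℝ => f (√s • z) := hf.comp (measurable_const_smul _)
  rw [stdNormalPi_eq_withDensity, lintegral_withDensity_eq_lintegral_mul _
    measurable_stdNormalPDFReal.ennreal_ofReal hfs]
  have h := lintegral_map (μ := (volume : Measure (ι → ℝ)))
    (hφ.ennreal_ofReal.mul hf) (measurable_const_smul (√s))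
  rw [Measure.map_addHaar_smul _ hs', lintegral_smul_measure] at h
  simp only [Pi.mul_apply, smul_smul, inv_mul_cancel₀ hs', one_smul,
    Module.finrank_fintype_fun_eq_card] at h
  simp only [Pi.mul_apply]
  rw [← h, smul_eq_mul, ← lintegral_const_mul]
  · refine lintegral_congr fun d => ?_
    rw [abs_of_nonneg (by positivity), ENNReal.ofReal_mul (by positivity), mul_assoc]
  · exact hφ.ennreal_ofReal.mul hf

/-- For independent `s ∼ IG(a, r)` and standard normal `z`, the vector `d = √s • z` has the density
`mixturePDFReal a r`, and given `d` the law of `s` is `IG(a + k / 2, r + dᵀ d / 2)`, that is, the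
law of `(r + dᵀ d / 2) * t` for `t ∼ IG(a + k / 2, 1)`. -/
theorem invGamma_prod_stdNormalPi_map {a r : ℝ} (ha : 0 < a) (hr : 0 < r) :
    ((invGamma a r).prod (stdNormalPi ι)).map (fun p => (√p.1 • p.2, p.1)) =
      (((volume : Measure (ι → ℝ)).withDensity
        fun d => ENNReal.ofReal (mixturePDFReal a r d)).prod
          (invGamma (a + Fintype.card ι / 2) 1)).map
            (fun p => (p.1, (r + p.1 ⬝ᵥ p.1 / 2) * p.2)) := by
  have ha' : 0 < a + Fintype.card ι / 2 := by positivity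
  have := isProbabilityMeasure_invGamma ha hr
  have := isProbabilityMeasure_invGamma ha' one_pos
  have hR := (continuous_add_dotProduct_self (ι := ι) r).measurable
  have hm1 : Measurable fun p : ℝ × (ι → ℝ) => (√p.1 • p.2, p.1) := by fun_prop
  have hm2 : Measurable fun p : (ι → ℝ) × ℝ => (p.1, (r + p.1 ⬝ᵥ p.1 / 2) * p.2) :=
    measurable_fst.prodMk ((hR.comp measurable_fst).mul measurable_snd)
  refine Measure.ext_of_lintegral _ fun f hf => ?_
  have hf1 : Measurable fun p : ℝ × (ι → ℝ) => f (√p.1 • p.2, p.1) := hf.comp hm1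
  have hf2 : Measurable fun p : (ι → ℝ) × ℝ => f (p.1, (r + p.1 ⬝ᵥ p.1 / 2) * p.2) := hf.comp hm2
  rw [lintegral_map hf hm1, lintegral_map hf hm2, lintegral_prod _ hf1.aemeasurable,
    lintegral_prod _ hf2.aemeasurable]
  have hleft : Measurable fun s : ℝ => ∫⁻ z, f (√s • z, s) ∂stdNormalPi ι :=
    hf1.lintegral_prod_right'
  have hright : Measurable fun d : ι → ℝ =>
      ∫⁻ t, f (d, (r + d ⬝ᵥ d / 2) * t) ∂invGamma (a + Fintype.card ι / 2) 1 :=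
    hf2.lintegral_prod_right'
  conv_lhs => rw [invGamma, lintegral_withDensity_eq_lintegral_mul _
    (measurable_invGammaPDFReal a r).ennreal_ofReal hleft]
  rw [lintegral_withDensity_eq_lintegral_mul _ (measurable_mixturePDFReal a r).ennreal_ofReal
    hright]
  simp only [Pi.mul_apply]
  -- The joint density of (s, d) in factored form, times the test function. Both sides become
  -- iterated integrals of `k`, in opposite orders, and Tonelli compares them.
  let k : ℝ → (ι → ℝ) → ENNReal := fun s d => ENNReal.ofReal (mixturePDFReal a r d) *
    (ENNReal.ofReal (invGammaPDFReal (a + Fintype.card ι / 2) (r + d ⬝ᵥ d / 2) s) * f (d, s))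
  have hpdf : Measurable fun p : ℝ × (ι → ℝ) =>
      invGammaPDFReal (a + Fintype.card ι / 2) (r + p.2 ⬝ᵥ p.2 / 2) p.1 := by
    have : Measurable fun p : ℝ × (ι → ℝ) => r + p.2 ⬝ᵥ p.2 / 2 := hR.comp measurable_snd
    unfold invGammaPDFReal
    refine Measurable.ite (measurableSet_Ioi.preimage measurable_fst) ?_ measurable_const
    fun_prop
  have hk : Measurable (Function.uncurry k) :=
    ((measurable_mixturePDFReal a r).comp measurable_snd).ennreal_ofReal.mul
      (hpdf.ennreal_ofReal.mul (hf.comp measurable_swap))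
  trans ∫⁻ s, ∫⁻ d, k s d
  · refine lintegral_congr fun s => ?_
    by_cases hs : 0 < s
    · rw [lintegral_stdNormalPi_smul hs (f := fun d => f (d, s)) (by fun_prop),
        ← lintegral_const_mul]
      · refine lintegral_congr fun d => ?_
        simp only [k]
        rw [← mul_assoc, ← ENNReal.ofReal_mul (invGammaPDFReal_nonneg ha hr s),
          invGammaPDFReal_mul_stdNormalPDFReal ha hr hs,
          ENNReal.ofReal_mul (mixturePDFReal_pos ha hr d).le, mul_assoc]
      · exact ((measurable_stdNormalPDFReal.comp (measurable_const_smul _)).const_mul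
          _).ennreal_ofReal.mul (by fun_prop)
    -- For s ≤ 0 both inverse-gamma densities vanish, so the value of √s there is irrelevant.
    · simp [k, invGammaPDFReal, hs]
  · rw [lintegral_lintegral_swap hk.aemeasurable]
    refine lintegral_congr fun d => ?_
    have hfd : Measurable fun s => f (d, s) := by fun_prop
    have hg : Measurable fun s => ENNReal.ofReal
        (invGammaPDFReal (a + Fintype.card ι / 2) (r + d ⬝ᵥ d / 2) s) * f (d, s) :=
      (measurable_invGammaPDFReal _ _).ennreal_ofReal.mul hfd
    simp only [k]
    rw [lintegral_const_mul _ hg, ← lintegral_map (μ := invGamma _ 1) hfd (measurable_const_mul _),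
      invGamma_map_mul _ (add_dotProduct_self_pos hr d), invGamma,
      lintegral_withDensity_eq_lintegral_mul _ (measurable_invGammaPDFReal _ _).ennreal_ofReal hfd]
    rfl

end Mixture

/-! ### Conditional laws from a functional representation -/

section FunctionalRepresentation

variable {Ω 𝓧 𝓨 𝓤 : Type*} [MeasurableSpace Ω] [MeasurableSpace 𝓧] [MeasurableSpace 𝓨]
  [MeasurableSpace 𝓤]

/-- The kernel `x ↦ law of F x u` for `u` with law `ρ`. -/
def mapKernel (ρ : Measure 𝓤) [SFinite ρ] (F : 𝓧 → 𝓤 → 𝓨) : Kernel 𝓧 𝓨 :=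
  (Kernel.id ×ₖ Kernel.const 𝓧 ρ).map (Function.uncurry F)

theorem mapKernel_apply (ρ : Measure 𝓤) [SFinite ρ] {F : 𝓧 → 𝓤 → 𝓨}
    (hF : Measurable (Function.uncurry F)) (x : 𝓧) : mapKernel ρ F x = ρ.map (F x) := by
  rw [mapKernel, Kernel.map_apply _ hF, Kernel.prod_apply, Kernel.id_apply, Kernel.const_apply,
    Measure.dirac_prod, Measure.map_map hF (by fun_prop)]
  rfl

/-- If `κ x` is the law of `F x u`, then `μ ⊗ₘ κ` is the law of `(x, F x u)` for independent `x`
and `u`. -/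
theorem compProd_eq_map_prod (μ : Measure 𝓧) [SFinite μ] (ρ : Measure 𝓤) [SFinite ρ]
    {F : 𝓧 → 𝓤 → 𝓨} (hF : Measurable (Function.uncurry F)) (κ : Kernel 𝓧 𝓨) [IsSFiniteKernel κ]
    (hκ : ∀ x, κ x = ρ.map (F x)) :
    μ ⊗ₘ κ = (μ.prod ρ).map fun p => (p.1, F p.1 p.2) := by
  have hm : Measurable fun p : 𝓧 × 𝓤 => (p.1, F p.1 p.2) := measurable_fst.prodMk hF
  ext B hB
  rw [Measure.compProd_apply hB, Measure.map_apply hm hB, Measure.prod_apply (hm hB)]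
  refine lintegral_congr fun x => ?_
  have hFx : Measurable (F x) := hF.comp measurable_prodMk_left
  rw [hκ, Measure.map_apply hFx (measurable_prodMk_left hB)]
  rfl

variable [TopologicalSpace 𝓧] [TopologicalSpace 𝓨]

/-- Two weakly continuous versions of a conditional distribution agree everywhere if the law of the
conditioning variable charges every nonempty open set. -/
theorem IsContCondDistrib.eq_of_isOpenPosMeasure [HasOuterApproxClosed 𝓨] [BorelSpace 𝓨]
    [MeasurableSpace.CountableOrCountablyGenerated 𝓧 𝓨]
    {P : Measure Ω} [IsFiniteMeasure P] {X : Ω → 𝓧} {Y : Ω → 𝓨} [(P.map X).IsOpenPosMeasure]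
    {κ η : Kernel 𝓧 𝓨} (hκ : IsContCondDistrib Y X κ P) (hη : IsContCondDistrib Y X η P) (x : 𝓧) :
    κ x = η x := by
  have := hκ.isMarkov
  have := hη.isMarkov
  have hae : κ =ᵐ[P.map X] η :=
    Kernel.ae_eq_of_compProd_eq (hκ.hasCondDistrib.map_eq.symm.trans hη.hasCondDistrib.map_eq)
  refine ext_of_forall_integral_eq_of_IsFiniteMeasure fun f => ?_
  have h : (fun x => ∫ y, f y ∂κ x) =ᵐ[P.map X] fun x => ∫ y, f y ∂η x :=
    hae.mono fun x hx => by simp only [hx]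
  exact congrFun (Continuous.ae_eq_iff_eq _ (hκ.continuous f) (hη.continuous f) |>.1 h) x

/-- If `(X, Y)` has the law of `(x, F x u)` for independent `x` and `u` with laws `μ` and `ρ`, where
`F` is continuous in `x` and `μ` charges every nonempty open set, then the conditional law of `Y`
given `X = x` is the law of `F x u`. -/
theorem isCondLawAt_of_map_eq [FirstCountableTopology 𝓧] [HasOuterApproxClosed 𝓨] [BorelSpace 𝓨]
    [MeasurableSpace.CountableOrCountablyGenerated 𝓧 𝓨]
    {P : Measure Ω} [IsProbabilityMeasure P] {X : Ω → 𝓧} {Y : Ω → 𝓨}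
    (hX : AEMeasurable X P) (hY : AEMeasurable Y P)
    {μ : Measure 𝓧} [SFinite μ] [μ.IsOpenPosMeasure] {ρ : Measure 𝓤} [IsProbabilityMeasure ρ]
    {F : 𝓧 → 𝓤 → 𝓨} (hF : Measurable (Function.uncurry F))
    (hFc : ∀ u, Continuous fun x => F x u)
    (h : P.map (fun ω => (X ω, Y ω)) = (μ.prod ρ).map fun p => (p.1, F p.1 p.2)) (x : 𝓧) :
    IsCondLawAt Y X x (ρ.map (F x)) P := by
  have hm : Measurable fun p : 𝓧 × 𝓤 => (p.1, F p.1 p.2) := measurable_fst.prodMk hF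
  have hF' : ∀ x, Measurable (F x) := fun x => hF.comp measurable_prodMk_left
  have hμ : P.map X = μ := by
    have h1 := congrArg (Measure.map Prod.fst) h
    rw [AEMeasurable.map_map_of_aemeasurable (by fun_prop) (by fun_prop),
      Measure.map_map measurable_fst hm] at h1
    have h2 : (μ.prod ρ).map Prod.fst = μ := by
      rw [Measure.map_fst_prod, measure_univ, one_smul]
    exact h1.trans h2
  have : (P.map X).IsOpenPosMeasure := hμ ▸ inferInstance
  have hmarkov : IsMarkovKernel (mapKernel ρ F) :=
    ⟨fun x => by
      rw [mapKernel_apply ρ hF]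
      exact Measure.isProbabilityMeasure_map (hF' x).aemeasurable⟩
  have hκ : IsContCondDistrib Y X (mapKernel ρ F) P := by
    refine ⟨hmarkov, ⟨hX.prodMk hY, ?_⟩, fun f => ?_⟩
    · rw [h, hμ, compProd_eq_map_prod μ ρ hF _ (mapKernel_apply ρ hF)]
    · have hfm : Measurable f := f.continuous.measurable
      have : (fun x => ∫ y, f y ∂mapKernel ρ F x) = fun x => ∫ u, f (F x u) ∂ρ := by
        funext x
        rw [mapKernel_apply ρ hF, integral_map (hF' x).aemeasurable
          hfm.aestronglyMeasurable]
      rw [this]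
      refine continuous_of_dominated (bound := fun _ => ‖f‖)
        (fun x => (hfm.comp (hF' x)).aestronglyMeasurable)
        (fun x => ae_of_all _ fun u => f.norm_coe_le_norm _) (integrable_const _)
        (ae_of_all _ fun u => f.continuous.comp (hFc u))
  refine ⟨⟨_, hκ⟩, fun η hη => ?_⟩
  rw [hη.eq_of_isOpenPosMeasure hκ x, mapKernel_apply ρ hF]

end FunctionalRepresentation

/-! ### Linear images of the standard Gaussian distribution -/

section LinearImage

variable {n : ℕ} {ι κ : Type*} [Fintype ι] [Fintype κ]

/-- The law of `M z` for a standard normal vector `z`. -/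
def gaussianImage (M : Matrix (Fin n) ι ℝ) : Measure (EuclideanSpace ℝ (Fin n)) :=
  (stdNormalPi ι).map fun z => WithLp.toLp 2 (M *ᵥ z)

theorem measurable_toLp_mulVec (M : Matrix (Fin n) ι ℝ) :
    Measurable fun z : ι → ℝ => (WithLp.toLp 2 (M *ᵥ z) : EuclideanSpace ℝ (Fin n)) := by
  have : Continuous fun z : ι → ℝ => M *ᵥ z := by fun_prop
  fun_prop

instance (M : Matrix (Fin n) ι ℝ) : IsProbabilityMeasure (gaussianImage M) :=
  Measure.isProbabilityMeasure_map (measurable_toLp_mulVec M).aemeasurable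

/-- Moving M across the inner product, ⟨M z, x⟩ = ⟨z, Mᵀ x⟩, leaves the standard characteristic
function at Mᵀ x, and |Mᵀ x|² = xᵀ M Mᵀ x. -/
theorem charFun_gaussianImage (M : Matrix (Fin n) ι ℝ) (x : EuclideanSpace ℝ (Fin n)) :
    charFun (gaussianImage M) x =
      Complex.exp (-((x.ofLp ⬝ᵥ ((M * Mᵀ) *ᵥ x.ofLp) : ℝ) : ℂ) / 2) := by
  have h1 : charFun (gaussianImage M) x =
      charFun (stdGaussian (EuclideanSpace ℝ ι)) (WithLp.toLp 2 (Mᵀ *ᵥ x.ofLp)) := by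
    rw [← map_pi_eq_stdGaussian, charFun_apply, charFun_apply, gaussianImage,
      integral_map (measurable_toLp_mulVec M).aemeasurable (by fun_prop),
      integral_map (by fun_prop) (by fun_prop)]
    refine integral_congr_ae (ae_of_all _ fun z => ?_)
    simp only [EuclideanSpace.inner_eq_star_dotProduct, star_trivial]
    rw [dotProduct_mulVec, mulVec_transpose]
  rw [h1, charFun_stdGaussian, ← Complex.ofReal_pow, EuclideanSpace.real_norm_sq_eq]
  congr 4
  rw [← mulVec_mulVec, dotProduct_mulVec, ← mulVec_transpose]
  simp [dotProduct, pow_two]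

/-- The law of `M z` depends only on the covariance matrix `M Mᵀ`. -/
theorem gaussianImage_congr {M : Matrix (Fin n) ι ℝ} {N : Matrix (Fin n) κ ℝ}
    (h : M * Mᵀ = N * Nᵀ) : gaussianImage M = gaussianImage N := by
  refine Measure.ext_of_charFun (funext fun x => ?_)
  rw [charFun_gaussianImage, charFun_gaussianImage, h]

/-- A sum of independent centered Gaussian vectors is Gaussian, and the covariances add up. -/
theorem gaussianImage_eq_map_prod {μ : Type*} [Fintype μ] {M : Matrix (Fin n) ι ℝ}
    {N : Matrix (Fin n) κ ℝ} {R : Matrix (Fin n) μ ℝ} (h : R * Rᵀ = M * Mᵀ + N * Nᵀ) :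
    gaussianImage R = ((stdNormalPi ι).prod (stdNormalPi κ)).map
      fun p => WithLp.toLp 2 (M *ᵥ p.1 + N *ᵥ p.2) := by
  have hconv : ((stdNormalPi ι).prod (stdNormalPi κ)).map
      (fun p => (WithLp.toLp 2 (M *ᵥ p.1 + N *ᵥ p.2) : EuclideanSpace ℝ (Fin n))) =
      (gaussianImage M).conv (gaussianImage N) := by
    rw [Measure.conv, gaussianImage, gaussianImage, Measure.map_prod_map _ _
      (measurable_toLp_mulVec M) (measurable_toLp_mulVec N), Measure.map_map (by fun_prop)
      ((measurable_toLp_mulVec M).prodMap (measurable_toLp_mulVec N))]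
    rfl
  rw [hconv]
  refine Measure.ext_of_charFun (funext fun x => ?_)
  rw [charFun_conv, charFun_gaussianImage, charFun_gaussianImage, charFun_gaussianImage, h,
    ← Complex.exp_add, add_mulVec, dotProduct_add, Complex.ofReal_add]
  congr 1
  ring

open scoped MatrixOrder in
theorem sqrt_mul_transpose_sqrt {S : Matrix (Fin n) (Fin n) ℝ} (hS : S.PosSemidef) :
    CFC.sqrt S * (CFC.sqrt S)ᵀ = S := by
  have h : (CFC.sqrt S).PosSemidef := Matrix.nonneg_iff_posSemidef.1 (CFC.sqrt_nonneg S)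
  have h2 : (CFC.sqrt S)ᵀ = CFC.sqrt S := by
    simpa [conjTranspose_eq_transpose_of_trivial] using h.isHermitian.eq
  rw [h2, CFC.sqrt_mul_sqrt_self _ hS.nonneg]

open scoped MatrixOrder in
-- No sign condition on s is needed: for s ≤ 0 both sides are the point mass at μ, as √s = 0.
theorem multivariateGaussian_smul_eq_map (μ : EuclideanSpace ℝ (Fin n))
    {S : Matrix (Fin n) (Fin n) ℝ} (hS : S.PosSemidef) (s : ℝ) :
    multivariateGaussian μ (s • S) =
      (gaussianImage (CFC.sqrt S)).map fun y => μ + √s • y := by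
  rw [multivariateGaussian_smul μ hS, ← map_pi_eq_stdGaussian, gaussianImage, stdNormalPi,
    Measure.map_map (by fun_prop) (by fun_prop),
    Measure.map_map (by fun_prop) (measurable_toLp_mulVec _)]
  rfl

end LinearImage

/-! ### The Student distribution as a scale mixture of Gaussian distributions -/

section Student

variable {n : ℕ} {S : Matrix (Fin n) (Fin n) ℝ}

theorem specU_transpose_mul_specU (hS : S.IsHermitian) : (specU hS)ᵀ * specU hS = 1 := by
  ext i j
  have h := congrFun (congrFun (Unitary.coe_star_mul_self hS.eigenvectorUnitary) i.1) j.1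
  simpa [Matrix.mul_apply, specU, Matrix.one_apply, Subtype.ext_iff, star_apply] using h

/-- The zero eigenvalues dropped in the reduced decomposition contribute nothing to the full
spectral sum. -/
theorem specU_mul_diagonal_mul_transpose (hS : S.IsHermitian) :
    specU hS * diagonal (specD hS) * (specU hS)ᵀ = S := by
  conv_rhs => rw [hS.spectral_theorem, Unitary.conjStarAlgAut_apply]
  ext i j
  rw [Matrix.mul_apply, Matrix.mul_apply]
  simp only [mul_diagonal, specU, specD, transpose_apply, star_apply, star_trivial]
  rw [← Finset.sum_subtype (Finset.univ.filter fun k => hS.eigenvalues k ≠ 0) (by simp)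
    (fun k => (hS.eigenvectorUnitary : Matrix (Fin n) (Fin n) ℝ) i k * hS.eigenvalues k *
      (hS.eigenvectorUnitary : Matrix (Fin n) (Fin n) ℝ) j k)]
  refine Finset.sum_subset (Finset.filter_subset _ _) fun k _ hk => ?_
  simp only [Finset.mem_filter, Finset.mem_univ, true_and, not_not] at hk
  simp [hk]

theorem specD_pos (hS : S.PosSemidef) (j : SpecIdx hS.isHermitian) : 0 < specD hS.isHermitian j :=
  lt_of_le_of_ne (hS.eigenvalues_nonneg j.1) j.2.symm

theorem dotProduct_pinv_specU (hS : S.IsHermitian) (v : SpecIdx hS → ℝ) :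
    (specU hS *ᵥ v) ⬝ᵥ (pinv hS *ᵥ (specU hS *ᵥ v)) = ∑ j, v j ^ 2 / specD hS j := by
  have h : pinv hS * specU hS = specU hS * diagonal fun j => (specD hS j)⁻¹ := by
    rw [pinv, Matrix.mul_assoc, specU_transpose_mul_specU, Matrix.mul_one]
  rw [mulVec_mulVec, h, ← mulVec_mulVec, dotProduct_mulVec, ← mulVec_transpose, mulVec_mulVec,
    specU_transpose_mul_specU, one_mulVec]
  simp only [dotProduct, mulVec_diagonal]
  refine Finset.sum_congr rfl fun j _ => ?_
  ring

/-- In the coordinates v = diag(w) d with w_j² = (a/r) D_j, the quadratic form is (a/r) dᵀd, so with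
ν = 2a the Student base equals (r + dᵀd/2)/r. The Jacobian ∏ w_j cancels √det D. -/
theorem studentPDFReal_specU {a r : ℝ} (ha : 0 < a) (hr : 0 < r) (hS : S.PosSemidef)
    (μ : EuclideanSpace ℝ (Fin n)) (d : SpecIdx hS.isHermitian → ℝ) :
    (∏ j, √(a / r * specD hS.isHermitian j)) * studentPDFReal (2 * a) μ hS.isHermitian
      (μ + WithLp.toLp 2 (specU hS.isHermitian *ᵥ
        fun j => √(a / r * specD hS.isHermitian j) * d j)) = mixturePDFReal a r d := by
  set k := Fintype.card (SpecIdx hS.isHermitian)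
  have hrank : S.rank = k := hS.isHermitian.rank_eq_card_non_zero_eigs
  have hD := specD_pos hS
  have hq : 0 ≤ d ⬝ᵥ d := Finset.sum_nonneg fun i _ => mul_self_nonneg _
  have hprod : 0 < ∏ j, specD hS.isHermitian j := Finset.prod_pos fun j _ => hD j
  have hquad : ∑ j, (√(a / r * specD hS.isHermitian j) * d j) ^ 2 / specD hS.isHermitian j =
      a / r * (d ⬝ᵥ d) := by
    rw [dotProduct, Finset.mul_sum]
    refine Finset.sum_congr rfl fun j _ => ?_
    have := hD j
    rw [mul_pow, Real.sq_sqrt (by positivity)]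
    field_simp
  have hw : ∏ j, √(a / r * specD hS.isHermitian j) =
      √((a / r) ^ k * ∏ j, specD hS.isHermitian j) := by
    rw [← Real.sqrt_prod _ fun j _ => by have := hD j; positivity, Finset.prod_mul_distrib,
      Finset.prod_const, Finset.card_univ]
  rw [studentPDFReal, hrank, add_sub_cancel_left, dotProduct_pinv_specU, hquad, hw, mixturePDFReal]
  have h1 : √((a / r) ^ k * ∏ j, specD hS.isHermitian j) /
      √((Real.pi * (2 * a)) ^ k * ∏ j, specD hS.isHermitian j) =
      (2 * Real.pi) ^ (-(k / 2 : ℝ)) * r ^ (-(k / 2 : ℝ)) := by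
    rw [← Real.sqrt_div (by positivity), mul_div_mul_right _ _ hprod.ne', ← div_pow,
      show a / r / (Real.pi * (2 * a)) = (2 * Real.pi * r)⁻¹ by field_simp, Real.sqrt_eq_rpow,
      ← Real.rpow_natCast, ← Real.rpow_mul (by positivity), Real.inv_rpow (by positivity),
      ← Real.rpow_neg (by positivity), ← Real.mul_rpow (by positivity) hr.le]
    congr 1
    ring
  have h2 : (r + d ⬝ᵥ d / 2) ^ (-(a + k / 2 : ℝ)) =
      r ^ (-(a + k / 2 : ℝ)) * (1 + 1 / (2 * a) * (a / r * (d ⬝ᵥ d))) ^ (-(a + k / 2 : ℝ)) := by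
    rw [← Real.mul_rpow hr.le (by positivity)]
    congr 1
    field_simp
  have h3 : r ^ (-(k / 2 : ℝ)) = r ^ a * r ^ (-(a + k / 2 : ℝ)) := by
    rw [← Real.rpow_add hr]
    congr 1
    ring
  rw [h2, show (2 * a + k) / 2 = a + k / 2 by ring, show 2 * a / 2 = a by ring]
  rw [h3] at h1
  have h4 : ∀ x y z g e : ℝ, x * (g / (z * y) * e) = x / y * (g / z * e) := by
    intro x y z g e
    rw [div_mul_eq_div_div]
    ring
  rw [h4, h1]
  ring

theorem measurable_studentPDFReal (ν : ℝ) (μ : EuclideanSpace ℝ (Fin n)) (hS : S.IsHermitian) :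
    Measurable (studentPDFReal ν μ hS) := by
  have : Continuous fun x : EuclideanSpace ℝ (Fin n) =>
      (x - μ).ofLp ⬝ᵥ (pinv hS *ᵥ (x - μ).ofLp) := by
    simp only [dotProduct, mulVec]
    fun_prop
  have := this.measurable
  unfold studentPDFReal
  fun_prop

/-- The image of the mixture density under the diagonal scaling and the isometric parametrization
of `μ + range S` is the Student distribution. -/
theorem map_withDensity_mixturePDFReal {a r : ℝ} (ha : 0 < a) (hr : 0 < r) (hS : S.PosSemidef)
    (μ : EuclideanSpace ℝ (Fin n)) :
    ((volume : Measure (SpecIdx hS.isHermitian → ℝ)).withDensity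
      fun d => ENNReal.ofReal (mixturePDFReal a r d)).map (fun d => μ + WithLp.toLp 2
        (specU hS.isHermitian *ᵥ fun j => √(a / r * specD hS.isHermitian j) * d j)) =
      multivariateStudent (2 * a) μ S := by
  set L : (SpecIdx hS.isHermitian → ℝ) → EuclideanSpace ℝ (Fin n) :=
    fun v => μ + WithLp.toLp 2 (specU hS.isHermitian *ᵥ v)
  set w : SpecIdx hS.isHermitian → ℝ := fun j => √(a / r * specD hS.isHermitian j)
  have hLm : Measurable L := measurable_const.add (measurable_toLp_mulVec _)
  have hwpos : ∀ j, 0 < w j := fun j => Real.sqrt_pos.2 (by have := specD_pos hS j; positivity)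
  have hwm : Measurable fun d : SpecIdx hS.isHermitian → ℝ => fun j => w j * d j := by fun_prop
  have hvol : (volume : Measure (SpecIdx hS.isHermitian → ℝ)) =
      ENNReal.ofReal (∏ j, w j) • volume.map fun (d : SpecIdx hS.isHermitian → ℝ) j => w j * d j := by
    have hdet : (diagonal w).det ≠ 0 := by
      rw [det_diagonal]
      exact Finset.prod_ne_zero_iff.2 fun j _ => (hwpos j).ne'
    have h := Real.map_matrix_volume_pi_eq_smul_volume_pi hdet
    have hfun : ⇑(toLin' (diagonal w)) = fun (d : SpecIdx hS.isHermitian → ℝ) j => w j * d j := by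
      funext d j
      simp [mulVec_diagonal]
    rw [hfun, det_diagonal] at h
    have hp : 0 < ∏ j, w j := Finset.prod_pos fun j _ => hwpos j
    rw [h, smul_smul, ← ENNReal.ofReal_mul hp.le, abs_of_pos (inv_pos.2 hp),
      mul_inv_cancel₀ hp.ne', ENNReal.ofReal_one, one_smul]
  have hf := (measurable_studentPDFReal (2 * a) μ hS.isHermitian).ennreal_ofReal
  have hfL : Measurable fun v => ENNReal.ofReal
      (studentPDFReal (2 * a) μ hS.isHermitian (L v)) := hf.comp hLm
  ext B hB
  have hT : Measurable fun d : SpecIdx hS.isHermitian → ℝ => L fun j => w j * d j := hLm.comp hwm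
  rw [multivariateStudent, dif_pos hS, Measure.map_apply hT hB,
    withDensity_apply _ (hT hB), withDensity_apply _ hB, affineVolume, setLIntegral_map hB hf hLm]
  conv_rhs => rw [hvol]
  rw [Measure.restrict_smul, lintegral_smul_measure, setLIntegral_map (hLm hB) hfL hwm,
    smul_eq_mul, ← lintegral_const_mul]
  · refine setLIntegral_congr_fun (hT hB) fun d _ => ?_
    rw [← ENNReal.ofReal_mul (Finset.prod_nonneg fun j _ => (hwpos j).le),
      ← studentPDFReal_specU ha hr hS μ d]
  · exact hf.comp hT

/-- If `s ∼ IG(a, r)` and, given `s`, the vector `x` has the law `N(μ, s R Rᵀ)`, then `x` has the law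
`St_{2a}(μ, (r / a) R Rᵀ)`. -/
theorem invGamma_prod_gaussianImage_map {ι : Type*} [Fintype ι] {a r : ℝ} (ha : 0 < a) (hr : 0 < r)
    (μ : EuclideanSpace ℝ (Fin n)) {Ψ : Matrix (Fin n) (Fin n) ℝ} (hΨ : Ψ.PosSemidef)
    {R : Matrix (Fin n) ι ℝ} (hR : R * Rᵀ = Ψ) :
    ((invGamma a r).prod (gaussianImage R)).map (fun p => μ + √p.1 • p.2) =
      multivariateStudent (2 * a) μ ((r / a) • Ψ) := by
  have := isProbabilityMeasure_invGamma ha hr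
  have hS : ((r / a) • Ψ).PosSemidef := hΨ.smul (by positivity)
  -- With S = (r/a) Ψ these weights give M Mᵀ = (a/r) S = Ψ. Hence M can replace R, and its number
  -- of columns is the rank, as the Student density requires.
  let w : SpecIdx hS.isHermitian → ℝ := fun j => √(a / r * specD hS.isHermitian j)
  let M := specU hS.isHermitian * diagonal w
  have hMw : ∀ d, M *ᵥ d = specU hS.isHermitian *ᵥ fun j => w j * d j := by
    intro d
    rw [← mulVec_mulVec]
    congr 1
    funext j
    rw [mulVec_diagonal]
  have hM : R * Rᵀ = M * Mᵀ := by
    have hw : diagonal w * diagonal w = (a / r) • diagonal (specD hS.isHermitian) := by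
      rw [diagonal_mul_diagonal, ← diagonal_smul]
      congr 1
      funext j
      have := specD_pos hS j
      exact Real.mul_self_sqrt (by positivity)
    rw [transpose_mul, diagonal_transpose, Matrix.mul_assoc, ← Matrix.mul_assoc (diagonal w), hw,
      Matrix.smul_mul, Matrix.mul_smul, ← Matrix.mul_assoc, specU_mul_diagonal_mul_transpose, smul_smul,
      hR, show a / r * (r / a) = 1 by field_simp, one_smul]
  have hmM := measurable_toLp_mulVec M
  have ha' : 0 < a + Fintype.card (SpecIdx hS.isHermitian) / 2 := by positivity
  have := isProbabilityMeasure_invGamma ha' one_pos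
  have hRm := (continuous_add_dotProduct_self (ι := SpecIdx hS.isHermitian) r).measurable
  have hmix := congrArg (Measure.map fun p : (SpecIdx hS.isHermitian → ℝ) × ℝ =>
    μ + WithLp.toLp 2 (M *ᵥ p.1)) (invGamma_prod_stdNormalPi_map (ι := SpecIdx hS.isHermitian) ha hr)
  have hm1 : Measurable fun p : (SpecIdx hS.isHermitian → ℝ) × ℝ => μ + WithLp.toLp 2 (M *ᵥ p.1) :=
    measurable_const.add (hmM.comp measurable_fst)
  have hm2 : Measurable fun p : (SpecIdx hS.isHermitian → ℝ) × ℝ =>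
      (p.1, (r + p.1 ⬝ᵥ p.1 / 2) * p.2) :=
    measurable_fst.prodMk ((hRm.comp measurable_fst).mul measurable_snd)
  rw [Measure.map_map hm1 (by fun_prop), Measure.map_map hm1 hm2] at hmix
  rw [gaussianImage_congr hM, gaussianImage]
  have hprod : (invGamma a r).prod ((stdNormalPi (SpecIdx hS.isHermitian)).map
      fun z => (WithLp.toLp 2 (M *ᵥ z) : EuclideanSpace ℝ (Fin n))) =
      ((invGamma a r).prod (stdNormalPi (SpecIdx hS.isHermitian))).map
        (Prod.map id fun z => WithLp.toLp 2 (M *ᵥ z)) := by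
    rw [← Measure.map_prod_map _ _ measurable_id hmM, Measure.map_id]
  rw [hprod, Measure.map_map (by fun_prop) (measurable_id.prodMap hmM),
    ← map_withDensity_mixturePDFReal ha hr hS μ]
  -- Only d = √s z matters here, so the inverse-gamma coordinate of the conjugacy identity is
  -- integrated out.
  trans (((volume : Measure (SpecIdx hS.isHermitian → ℝ)).withDensity
    fun d => ENNReal.ofReal (mixturePDFReal a r d)).prod
      (invGamma (a + Fintype.card (SpecIdx hS.isHermitian) / 2) 1)).map
        ((fun d => μ + WithLp.toLp 2 (M *ᵥ d)) ∘ Prod.fst)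
  · refine Eq.trans ?_ hmix
    congr 1
    funext p
    simp [mulVec_smul]
  · have hm3 : Measurable fun d : SpecIdx hS.isHermitian → ℝ => μ + WithLp.toLp 2 (M *ᵥ d) :=
      measurable_const.add hmM
    rw [← Measure.map_map hm3 measurable_fst, Measure.map_fst_prod,
      measure_univ, one_smul]
    simp_rw [hMw]
    rfl

end Student

/-! ### The Bayesian projection method -/

section Posterior

variable {n m : ℕ}

open scoped MatrixOrder in
-- The covariance is a sum, so the noise splits into independent parts: one that the observation
-- will determine and one that it will not see.
theorem gaussianScaleKernel_apply (V : Matrix (Fin n) (Fin m) ℝ) {Ψ : Matrix (Fin n) (Fin n) ℝ}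
    (hΨ : Ψ.PosSemidef) (x₀ : EuclideanSpace ℝ (Fin n)) (s : ℝ) :
    gaussianScaleKernel x₀ (V * Vᵀ + Ψ) (posSemidef_prior V hΨ) s =
      ((stdNormalPi (Fin m)).prod (stdNormalPi (Fin n))).map
        fun p => x₀ + √s • WithLp.toLp 2 (V *ᵥ p.1 + CFC.sqrt Ψ *ᵥ p.2) := by
  have hS := posSemidef_prior V hΨ
  have hcov : CFC.sqrt (V * Vᵀ + Ψ) * (CFC.sqrt (V * Vᵀ + Ψ))ᵀ =
      V * Vᵀ + CFC.sqrt Ψ * (CFC.sqrt Ψ)ᵀ := by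
    rw [sqrt_mul_transpose_sqrt hS, sqrt_mul_transpose_sqrt hΨ]
  have hm : Measurable fun p : (Fin m → ℝ) × (Fin n → ℝ) =>
      (WithLp.toLp 2 (V *ᵥ p.1 + CFC.sqrt Ψ *ᵥ p.2) : EuclideanSpace ℝ (Fin n)) :=
    ((measurable_toLp_mulVec V).comp measurable_fst).add
      ((measurable_toLp_mulVec (CFC.sqrt Ψ)).comp measurable_snd)
  change multivariateGaussian x₀ (s • (V * Vᵀ + Ψ)) = _
  rw [multivariateGaussian_smul_eq_map x₀ hS, gaussianImage_eq_map_prod hcov,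
    Measure.map_map (by fun_prop) hm]
  rfl

instance (μ : EuclideanSpace ℝ (Fin n)) (S : Matrix (Fin n) (Fin n) ℝ) (hS : S.PosSemidef) :
    IsMarkovKernel (gaussianScaleKernel μ S hS) :=
  ⟨fun s => inferInstanceAs (IsProbabilityMeasure (multivariateGaussian μ (s • S)))⟩

/-- (CR)(CR)ᵀ = CΨCᵀ = 0, and a real matrix N with N Nᵀ = 0 is zero. -/
theorem mul_sqrt_eq_zero {k : ℕ} {C : Matrix (Fin k) (Fin n) ℝ} {R Ψ : Matrix (Fin n) (Fin n) ℝ}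
    (hR : R * Rᵀ = Ψ) (h : C * Ψ = 0) : C * R = 0 := by
  have h1 : (C * R) * (C * R)ᴴ = 0 := by
    rw [conjTranspose_eq_transpose_of_trivial, transpose_mul, Matrix.mul_assoc,
      ← Matrix.mul_assoc R, hR, ← Matrix.mul_assoc, h, Matrix.zero_mul]
  exact self_mul_conjTranspose_eq_zero.1 h1

/-- For an observation `y` of `Wᵀ A x`, with `R Rᵀ = Ψ`, the pair `(s, x)` expressed through `y`,
`t ∼ IG(α + m / 2, 1)` and an independent standard normal vector `z`. -/
def posteriorMap (A : Matrix (Fin n) (Fin n) ℝ) (V W : Matrix (Fin n) (Fin m) ℝ)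
    (R : Matrix (Fin n) (Fin n) ℝ) (x₀ : EuclideanSpace ℝ (Fin n)) (β : ℝ) (y : Fin m → ℝ)
    (u : ℝ × (Fin n → ℝ)) : ℝ × EuclideanSpace ℝ (Fin n) :=
  let d := (Wᵀ * A * V)⁻¹ *ᵥ (y - Wᵀ *ᵥ (A *ᵥ x₀.ofLp))
  ((β + d ⬝ᵥ d / 2) * u.1,
    x₀ + WithLp.toLp 2 (V *ᵥ d) + √((β + d ⬝ᵥ d / 2) * u.1) • WithLp.toLp 2 (R *ᵥ u.2))

theorem continuous_posteriorMap (A : Matrix (Fin n) (Fin n) ℝ) (V W : Matrix (Fin n) (Fin m) ℝ)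
    (R : Matrix (Fin n) (Fin n) ℝ) (x₀ : EuclideanSpace ℝ (Fin n)) (β : ℝ) :
    Continuous (Function.uncurry (posteriorMap A V W R x₀ β)) := by
  have hd : Continuous fun p : (Fin m → ℝ) × (ℝ × (Fin n → ℝ)) =>
      (Wᵀ * A * V)⁻¹ *ᵥ (p.1 - Wᵀ *ᵥ (A *ᵥ x₀.ofLp)) := by fun_prop
  have hr := (continuous_add_dotProduct_self β).comp hd
  have hV : Continuous fun p : (Fin m → ℝ) × (ℝ × (Fin n → ℝ)) =>
      V *ᵥ ((Wᵀ * A * V)⁻¹ *ᵥ (p.1 - Wᵀ *ᵥ (A *ᵥ x₀.ofLp))) := by fun_prop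
  have hR : Continuous fun p : (Fin m → ℝ) × (ℝ × (Fin n → ℝ)) => R *ᵥ p.2.2 := by fun_prop
  have hs := hr.mul (continuous_fst.comp continuous_snd)
  exact hs.prodMk ((continuous_const.add ((PiLp.continuous_toLp 2 _).comp hV)).add
    ((Real.continuous_sqrt.comp hs).smul ((PiLp.continuous_toLp 2 _).comp hR)))

open scoped MatrixOrder in
/-- The joint law of the observation `Wᵀ A x` and of `(s, x)` under the prior. -/
theorem map_observation_prodMk_eq (A : Matrix (Fin n) (Fin n) ℝ) (V W : Matrix (Fin n) (Fin m) ℝ)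
    {Ψ : Matrix (Fin n) (Fin n) ℝ} (x₀ : EuclideanSpace ℝ (Fin n)) {α β : ℝ}
    (hWAV : (Wᵀ * A * V).det ≠ 0) (hΨ : Ψ.PosSemidef) (hWAΨ : Wᵀ * A * Ψ = 0)
    (hα : 0 < α) (hβ : 0 < β) {Ω : Type*} [MeasurableSpace Ω] {P : Measure Ω}
    {s : Ω → ℝ} {x : Ω → EuclideanSpace ℝ (Fin n)} (hs : HasLaw s (invGamma α β) P)
    (hx : HasCondDistrib x s (gaussianScaleKernel x₀ (V * Vᵀ + Ψ) (posSemidef_prior V hΨ)) P) :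
    P.map (fun ω => (Wᵀ *ᵥ (A *ᵥ (x ω).ofLp), (s ω, x ω))) =
      ((((volume : Measure (Fin m → ℝ)).withDensity
        fun d => ENNReal.ofReal (mixturePDFReal α β d)).map
          fun d => Wᵀ *ᵥ (A *ᵥ x₀.ofLp) + (Wᵀ * A * V) *ᵥ d).prod
            ((invGamma (α + m / 2) 1).prod (stdNormalPi (Fin n)))).map
              fun p => (p.1, posteriorMap A V W (CFC.sqrt Ψ) x₀ β p.1 p.2) := by
  set R := CFC.sqrt Ψ
  set τ := Wᵀ *ᵥ (A *ᵥ x₀.ofLp) with hτ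
  set ν := (volume : Measure (Fin m → ℝ)).withDensity
    fun d => ENNReal.ofReal (mixturePDFReal α β d)
  have hα' : 0 < α + m / 2 := by positivity
  have := isProbabilityMeasure_invGamma hα hβ
  have := isProbabilityMeasure_invGamma hα' one_pos
  have hWAR : Wᵀ * A * R = 0 := mul_sqrt_eq_zero (sqrt_mul_transpose_sqrt hΨ) hWAΨ
  have hmV := measurable_toLp_mulVec V
  have hmR := measurable_toLp_mulVec R
  have hVR : Measurable fun p : ℝ × ((Fin m → ℝ) × (Fin n → ℝ)) =>
      x₀ + √p.1 • (WithLp.toLp 2 (V *ᵥ p.2.1 + R *ᵥ p.2.2) : EuclideanSpace ℝ (Fin n)) :=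
    measurable_const.add (measurable_fst.sqrt.smul
      ((hmV.comp (measurable_fst.comp measurable_snd)).add
        (hmR.comp (measurable_snd.comp measurable_snd))))
  have hT : Measurable fun q : ℝ × EuclideanSpace ℝ (Fin n) => (Wᵀ *ᵥ (A *ᵥ q.2.ofLp), q) := by
    have : Continuous fun q : ℝ × EuclideanSpace ℝ (Fin n) => Wᵀ *ᵥ (A *ᵥ q.2.ofLp) := by fun_prop
    exact this.measurable.prodMk measurable_id
  have he : Measurable fun d : Fin m → ℝ => τ + (Wᵀ * A * V) *ᵥ d := by
    have : Continuous fun d : Fin m → ℝ => τ + (Wᵀ * A * V) *ᵥ d := by fun_prop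
    exact this.measurable
  have hprior : P.map (fun ω => (s ω, x ω)) =
      ((invGamma α β).prod ((stdNormalPi (Fin m)).prod (stdNormalPi (Fin n)))).map
        fun p => (p.1, x₀ + √p.1 • WithLp.toLp 2 (V *ᵥ p.2.1 + R *ᵥ p.2.2)) := by
    rw [(hs.prodMk_of_hasCondDistrib hx).map_eq]
    exact compProd_eq_map_prod _ _ hVR _ (gaussianScaleKernel_apply V hΨ x₀)
  -- `H` rebuilds observation, scale and solution from ((d, s), g). The prior side is brought to
  -- this form, so that conjugacy can be applied to the law of (d, s) alone.
  let H : ((Fin m → ℝ) × ℝ) × (Fin n → ℝ) → (Fin m → ℝ) × (ℝ × EuclideanSpace ℝ (Fin n)) :=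
    fun p => (τ + (Wᵀ * A * V) *ᵥ p.1.1,
      (p.1.2, x₀ + WithLp.toLp 2 (V *ᵥ p.1.1) + √p.1.2 • WithLp.toLp 2 (R *ᵥ p.2)))
  have hH : Measurable H :=
    (he.comp (measurable_fst.comp measurable_fst)).prodMk
      ((measurable_snd.comp measurable_fst).prodMk
        ((measurable_const.add (hmV.comp (measurable_fst.comp measurable_fst))).add
          ((measurable_snd.comp measurable_fst).sqrt.smul (hmR.comp measurable_snd))))
  have hΦ : Measurable fun p : ℝ × (Fin m → ℝ) => (√p.1 • p.2, p.1) := by fun_prop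
  have hΦ' : Measurable fun p : (Fin m → ℝ) × ℝ => (p.1, (β + p.1 ⬝ᵥ p.1 / 2) * p.2) :=
    measurable_fst.prodMk
      (((continuous_add_dotProduct_self β).measurable.comp measurable_fst).mul measurable_snd)
  have hG : Measurable fun p : (Fin m → ℝ) × (ℝ × (Fin n → ℝ)) =>
      (p.1, posteriorMap A V W R x₀ β p.1 p.2) :=
    measurable_fst.prodMk (continuous_posteriorMap A V W R x₀ β).measurable
  have hmix := invGamma_prod_stdNormalPi_map (ι := Fin m) hα hβ
  rw [Fintype.card_fin] at hmix
  have hleft : P.map (fun ω => (Wᵀ *ᵥ (A *ᵥ (x ω).ofLp), (s ω, x ω))) =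
      ((((invGamma α β).prod (stdNormalPi (Fin m))).map fun p => (√p.1 • p.2, p.1)).prod
        (stdNormalPi (Fin n))).map H := by
    have h1 : P.map (fun ω => (Wᵀ *ᵥ (A *ᵥ (x ω).ofLp), (s ω, x ω))) =
        (P.map fun ω => (s ω, x ω)).map fun q => (Wᵀ *ᵥ (A *ᵥ q.2.ofLp), q) := by
      rw [AEMeasurable.map_map_of_aemeasurable hT.aemeasurable hx.aemeasurable]
      rfl
    have h2 : (((invGamma α β).prod (stdNormalPi (Fin m))).map
        fun p => (√p.1 • p.2, p.1)).prod (stdNormalPi (Fin n)) =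
        (((invGamma α β).prod (stdNormalPi (Fin m))).prod (stdNormalPi (Fin n))).map
          (Prod.map (fun p => (√p.1 • p.2, p.1)) id) := by
      rw [← Measure.map_prod_map _ _ hΦ measurable_id, Measure.map_id]
    rw [h1, hprior, h2, Measure.map_map hT (measurable_fst.prodMk hVR),
      Measure.map_map hH (hΦ.prodMap measurable_id), ← Measure.prodAssoc_prod,
      Measure.map_map (hT.comp (measurable_fst.prodMk hVR)) MeasurableEquiv.prodAssoc.measurable]
    congr 1
    funext p
    obtain ⟨⟨t, z⟩, g⟩ := p
    -- The noise g drops out of the observation because WᵀAR = 0.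
    have hobs : Wᵀ *ᵥ (A *ᵥ (x₀.ofLp + √t • (V *ᵥ z + R *ᵥ g))) =
        τ + (Wᵀ * A * V) *ᵥ (√t • z) := by
      have hg : Wᵀ *ᵥ (A *ᵥ (R *ᵥ g)) = 0 := by
        rw [mulVec_mulVec, mulVec_mulVec, hWAR, zero_mulVec]
      rw [mulVec_add, mulVec_add, mulVec_smul, mulVec_smul, mulVec_add, mulVec_add, hg, add_zero,
        mulVec_smul, ← mulVec_mulVec, ← mulVec_mulVec]
    simp only [Function.comp_apply, MeasurableEquiv.prodAssoc, MeasurableEquiv.coe_mk,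
      Equiv.prodAssoc_apply, Prod.map_apply, id_eq, H, WithLp.ofLp_add, WithLp.ofLp_smul]
    rw [hobs]
    simp only [mulVec_smul, WithLp.toLp_add, WithLp.toLp_smul, smul_add, add_assoc]
  have hright : (ν.map fun d => τ + (Wᵀ * A * V) *ᵥ d).prod
      ((invGamma (α + m / 2) 1).prod (stdNormalPi (Fin n))) =
      ((ν.prod (invGamma (α + m / 2) 1)).prod (stdNormalPi (Fin n))).map
        (Prod.map (fun d => τ + (Wᵀ * A * V) *ᵥ d) id ∘ MeasurableEquiv.prodAssoc) := by
    rw [← Measure.map_map (he.prodMap measurable_id) MeasurableEquiv.prodAssoc.measurable,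
      Measure.prodAssoc_prod, ← Measure.map_prod_map _ _ he measurable_id, Measure.map_id]
  have hmid : ((ν.prod (invGamma (α + m / 2) 1)).map
      fun p => (p.1, (β + p.1 ⬝ᵥ p.1 / 2) * p.2)).prod (stdNormalPi (Fin n)) =
      ((ν.prod (invGamma (α + m / 2) 1)).prod (stdNormalPi (Fin n))).map
        (Prod.map (fun p => (p.1, (β + p.1 ⬝ᵥ p.1 / 2) * p.2)) id) := by
    rw [← Measure.map_prod_map _ _ hΦ' measurable_id, Measure.map_id]
  rw [hleft, hmix, hmid, Measure.map_map hH (hΦ'.prodMap measurable_id), hright,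
    Measure.map_map hG ((he.prodMap measurable_id).comp MeasurableEquiv.prodAssoc.measurable)]
  congr 1
  funext p
  obtain ⟨⟨d, t⟩, z⟩ := p
  have hd : (Wᵀ * A * V)⁻¹ *ᵥ (τ + (Wᵀ * A * V) *ᵥ d - τ) = d := by
    rw [add_sub_cancel_left, mulVec_mulVec, nonsing_inv_mul _ (isUnit_iff_ne_zero.2 hWAV),
      one_mulVec]
  simp only [Function.comp_apply, MeasurableEquiv.prodAssoc, MeasurableEquiv.coe_mk,
    Equiv.prodAssoc_apply, Prod.map_apply, id_eq, H, posteriorMap, ← hτ, hd]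

/-- The density of d is strictly positive, and an invertible B makes the affine map continuous and
onto. -/
theorem isOpenPosMeasure_observation (B : Matrix (Fin m) (Fin m) ℝ) (hB : B.det ≠ 0)
    (τ : Fin m → ℝ) {α β : ℝ} (hα : 0 < α) (hβ : 0 < β) :
    (((volume : Measure (Fin m → ℝ)).withDensity
      fun d => ENNReal.ofReal (mixturePDFReal α β d)).map
        fun d => τ + B *ᵥ d).IsOpenPosMeasure := by
  have hac : (volume : Measure (Fin m → ℝ)) ≪ volume.withDensity
      fun d => ENNReal.ofReal (mixturePDFReal α β d) :=
    withDensity_absolutelyContinuous' (measurable_mixturePDFReal α β).ennreal_ofReal.aemeasurable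
      (ae_of_all _ fun d => (ENNReal.ofReal_pos.2 (mixturePDFReal_pos hα hβ d)).ne')
  have := hac.isOpenPosMeasure
  have hc : Continuous fun d : Fin m → ℝ => τ + B *ᵥ d := by fun_prop
  refine hc.isOpenPosMeasure_map fun y => ⟨B⁻¹ *ᵥ (y - τ), ?_⟩
  simp only
  rw [mulVec_mulVec, mul_nonsing_inv _ (isUnit_iff_ne_zero.2 hB), one_mulVec, add_sub_cancel]

end Posterior

end

end ProbProj

open scoped MatrixOrder in
theorem lemma6 {n m : ℕ} (A : Matrix (Fin n) (Fin n) ℝ) (V W : Matrix (Fin n) (Fin m) ℝ)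
    (Ψ : Matrix (Fin n) (Fin n) ℝ) (b : Fin n → ℝ) (x₀ : EuclideanSpace ℝ (Fin n)) (α β : ℝ)
    (hA : IsUnit A) (hV : V.rank = m) (hW : W.rank = m) (hWAV : (Wᵀ * A * V).det ≠ 0)
    (hΨ : Ψ.PosSemidef) (hWAΨ : Wᵀ * A * Ψ = 0) (hα : 0 < α) (hβ : 0 < β)
    {Ω : Type*} [MeasurableSpace Ω] (P : Measure Ω) [IsProbabilityMeasure P]
    (s : Ω → ℝ) (x : Ω → EuclideanSpace ℝ (Fin n))
    (hs : HasLaw s (ProbProj.invGamma α β) P)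
    (hx : HasCondDistrib x s
      (ProbProj.gaussianScaleKernel x₀ (V * Vᵀ + Ψ) (ProbProj.posSemidef_prior V hΨ)) P)
    (δ : Fin m → ℝ) (hδ : δ = ProbProj.projCoeff A V W b x₀)
    (α' β' : ℝ) (hα' : α' = α + m / 2) (hβ' : β' = β + δ ⬝ᵥ δ / 2) :
    ProbProj.IsCondLawAt s (fun ω => Wᵀ *ᵥ (A *ᵥ (x ω).ofLp)) (Wᵀ *ᵥ b)
        (ProbProj.invGamma α' β') P ∧
      ProbProj.IsCondLawAt x (fun ω => Wᵀ *ᵥ (A *ᵥ (x ω).ofLp)) (Wᵀ *ᵥ b)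
        (ProbProj.multivariateStudent (2 * α') (ProbProj.projSolution A V W b x₀)
          ((β' / α') • Ψ)) P := by
  have hα'pos : 0 < α' := by rw [hα']; positivity
  have hβ'pos : 0 < β' := hβ' ▸ ProbProj.add_dotProduct_self_pos hβ δ
  have := ProbProj.isProbabilityMeasure_invGamma hα'pos one_pos
  have := ProbProj.isProbabilityMeasure_invGamma hα'pos hβ'pos
  have hlaw := ProbProj.map_observation_prodMk_eq A V W x₀ hWAV hΨ hWAΨ hα hβ hs hx
  have := ProbProj.isOpenPosMeasure_observation (Wᵀ * A * V) hWAV (Wᵀ *ᵥ (A *ᵥ x₀.ofLp)) hα hβ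
  rw [← hα'] at hlaw
  have hF := ProbProj.continuous_posteriorMap A V W (CFC.sqrt Ψ) x₀ β
  set F := ProbProj.posteriorMap A V W (CFC.sqrt Ψ) x₀ β with hFdef
  have hG : Measurable fun p : (Fin m → ℝ) × (ℝ × (Fin n → ℝ)) => (p.1, F p.1 p.2) :=
    measurable_fst.prodMk hF.measurable
  have hxm : AEMeasurable x P := hx.aemeasurable_snd
  have hsm : AEMeasurable s P := hs.aemeasurable
  have hXm : AEMeasurable (fun ω => Wᵀ *ᵥ (A *ᵥ (x ω).ofLp)) P := by
    have : Continuous fun v : EuclideanSpace ℝ (Fin n) => Wᵀ *ᵥ (A *ᵥ v.ofLp) := by fun_prop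
    exact this.measurable.comp_aemeasurable hxm
  have hlaw_s := congrArg (Measure.map (Prod.map id Prod.fst)) hlaw
  have hlaw_x := congrArg (Measure.map (Prod.map id Prod.snd)) hlaw
  rw [AEMeasurable.map_map_of_aemeasurable (by fun_prop) (hXm.prodMk (hsm.prodMk hxm)),
    Measure.map_map (by fun_prop) hG] at hlaw_s hlaw_x
  have hd : (Wᵀ * A * V)⁻¹ *ᵥ (Wᵀ *ᵥ b - Wᵀ *ᵥ (A *ᵥ x₀.ofLp)) = δ := by
    rw [hδ, ProbProj.projCoeff, mulVec_sub Wᵀ]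
  -- At y = Wᵀb the recovered d is δ, so the scale factor becomes β' and the centre becomes x₀ + Vδ.
  have hFb : ∀ u, F (Wᵀ *ᵥ b) u = (β' * u.1, ProbProj.projSolution A V W b x₀ +
      √(β' * u.1) • WithLp.toLp 2 (CFC.sqrt Ψ *ᵥ u.2)) := by
    intro u
    simp only [hFdef, ProbProj.posteriorMap, hd, ← hβ', ProbProj.projSolution, ← hδ]
  clear_value F
  have hscale := ProbProj.invGamma_map_mul α' hβ'pos
  have hmul : Measurable fun t : ℝ => β' * t := by fun_prop
  constructor
  · have hFm : Measurable (Function.uncurry fun y u => (F y u).1) :=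
      measurable_fst.comp hF.measurable
    have hFc : ∀ u, Continuous fun y => (F y u).1 := fun u =>
      continuous_fst.comp (hF.comp (Continuous.prodMk_left u))
    have h := ProbProj.isCondLawAt_of_map_eq hXm hsm hFm hFc hlaw_s (Wᵀ *ᵥ b)
    convert h using 1
    simp only [hFb]
    change _ = Measure.map ((fun t => β' * t) ∘ Prod.fst) _
    rw [← Measure.map_map hmul measurable_fst, Measure.map_fst_prod, measure_univ, one_smul, hscale]
  · have hFm : Measurable (Function.uncurry fun y u => (F y u).2) :=
      measurable_snd.comp hF.measurable
    have hFc : ∀ u, Continuous fun y => (F y u).2 := fun u =>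
      continuous_snd.comp (hF.comp (Continuous.prodMk_left u))
    have h := ProbProj.isCondLawAt_of_map_eq hXm hxm hFm hFc hlaw_x (Wᵀ *ᵥ b)
    convert h using 1
    simp only [hFb]
    have hmR := ProbProj.measurable_toLp_mulVec (CFC.sqrt Ψ)
    -- Here β' t has law IG(α', β') and R g is independent of it with covariance Ψ: this is the
    -- Student mixture.
    rw [← ProbProj.invGamma_prod_gaussianImage_map hα'pos hβ'pos _ hΨ
      (ProbProj.sqrt_mul_transpose_sqrt hΨ), ← hscale, ProbProj.gaussianImage,
      Measure.map_prod_map _ _ hmul hmR, Measure.map_map (by fun_prop) (hmul.prodMap hmR)]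
    rfl
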